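/- Let $X\subseteq\mathbb R^d$ be compact and convex, $f:\mathbb R^d\to\mathbb R$ convex, $A\in\mathbb R^{N\times d}$, $b\in\mathbb R^N$, and consider $\min\{f(x): Ax=b,\ x\in X\}$ with optimal value $f^*$. Let $F(\lambda)=\max_{x\in X}\{-\langle\lambda,Ax-b\rangle-f(x)\}$, $F^*=\inf_\lambda F(\lambda)$, and let $\Lambda^*$ be the set of minimizers of $F$. Let $\sigma_{\max}$ be the largest eigenvalue of $A^TA$ and $\mathcal P_A$ the orthogonal projection onto the column space of $A$; $\|\cdot\|$ is the Euclidean norm. Assume: (a) the feasible set $\{x\in X: Ax=b\}$ is nonempty and not a single point; (b) $D,M>0$ satisfy $\|x-y\|\le D$ for all $x,y\in X$ and $|f(x)|\le M$ for all $x\in X$; (c) $\Lambda^*\neq\emptyset$, and for some $\beta\in(0,1]$, $\delta>0$, $C_\delta>0$ one has $\mathrm{dist}(\lambda,\Lambda^*)\le C_\delta(F(\lambda)-F^*)^\beta$ whenever $F(\lambda)-F^*\le\delta$; (d) there is a unique $\nu^*\in\mathbb R^N$ with $\mathcal P_A\lambda^*=\nu^*$ for all $\lambda^*\in\Lambda^*$.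 *Algorithm 1*, $\mathrm{PDS}(\tilde\lambda,\tilde x,\mu,T)$: put $\lambda_0=\lambda_{-1}=\tilde\lambda$, $\theta_0=\theta_{-1}=1$, and for $t=0,\dots,T-1$ compute $\hat\lambda_t=\lambda_t+\theta_t(\theta_{t-1}^{-1}-1)(\lambda_t-\lambda_{t-1})$, the maximization step $x_t=\arg\max_{x\in X}\{-\langle\hat\lambda_t,Ax-b\rangle-f(x)-\frac\mu2\|x-\tilde x\|^2\}$, $\lambda_{t+1}=\hat\lambda_t+\frac{\mu}{\sigma_{\max}}(Ax_t-b)$ (for $A=0$, $\lambda_{t+1}=\hat\lambda_t$), and $\theta_{t+1}=\frac12\big(\sqrt{\theta_t^4+4\theta_t^2}-\theta_t^2\big)$. Output $\lambda_T$ and $\bar x_T=\big(\sum_{t<T}\theta_t^{-1}\big)^{-1}\sum_{t<T}\theta_t^{-1}x_t$. *Algorithm 2* (homotopy method): put $\mu_0=\varepsilon_0/D^2$, $\lambda^{(0)}=0$, let $\bar x^{(0)}\in X$ be arbitrary, let $K=\lceil\log_2(\varepsilon_0/\varepsilon)\rceil+1$, and for $k=1,\dots,K$ put $\mu_k=\mu_{k-1}/2$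 and $(\lambda^{(k)},\bar x^{(k)})=\mathrm{PDS}(\lambda^{(k-1)},\bar x^{(k-1)},\mu_k,T)$. Output $\bar x^{(K)}$. Let $\varepsilon_0\ge\max\{2M,1\}$, $0<\varepsilon\le\min\{\delta/2,2M,1\}$, and let the integer $T\ge1$ satisfy $$T\ \ge\ \frac{4DC_\delta\sqrt{\sigma_{\max}}\,(2M)^{\beta/2}}{\varepsilon^{2/(2+\beta)}}.$$ Then $\bar x^{(K)}\in X$ and, for every $\lambda^*\in\Lambda^*$, $$f(\bar x^{(K)})-f^*\le\Big(\frac{24\|\mathcal P_A\lambda^*\|(1+C_\delta)}{C_\delta^2(2M)^{\beta}}+\frac{6}{(2M)^{\beta}}+\frac14\Big)\varepsilon,\qquad \|A\bar x^{(K)}-b\|\le\frac{24(1+C_\delta)}{C_\delta^2(2M)^\beta}\,\varepsilon,$$ and the method performs exactly $T\,(\lceil\log_2(\varepsilon_0/\varepsilon)\rceil+1)$ maximization steps. In particular, for a fixed problem and fixed $\varepsilon_0$, with the smallest such $T$ the total number of maximization steps is $O\big(\varepsilon^{-2/(2+\beta)}\log_2(1/\varepsilon)\big)$ as $\varepsilon\to0^+$.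 -/

import Mathlib

open Set Filter Topology Asymptotics

noncomputable section

namespace Homotopy

/-- `ℝⁿ` with the Euclidean norm. -/
abbrev E (n : ℕ) := EuclideanSpace ℝ (Fin n)

variable {N d : ℕ}

/-- The constraint residual `A x - b`. -/
def residual (A : Matrix (Fin N) (Fin d) ℝ) (b : E N) (x : E d) : E N :=
  Matrix.toEuclideanLin A x - b

/-- The feasible set `{x ∈ X : A x - b = 0}`. -/
def feasibleSet (A : Matrix (Fin N) (Fin d) ℝ) (b : E N) (X : Set (E d)) : Set (E d) :=
  {x | x ∈ X ∧ residual A b x = 0}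

/-- The optimal primal value `f* = min {f x : x ∈ X, A x = b}`. -/
def primalValue (A : Matrix (Fin N) (Fin d) ℝ) (b : E N) (X : Set (E d)) (f : E d → ℝ) : ℝ :=
  sInf (f '' feasibleSet A b X)

/-- The (sign-flipped) Lagrange dual function `F(l) = max_{x ∈ X} (-⟨l, A x - b⟩ - f x)`. -/
def dualFn (A : Matrix (Fin N) (Fin d) ℝ) (b : E N) (X : Set (E d)) (f : E d → ℝ)
    (l : E N) : ℝ :=
  sSup ((fun x => -(inner ℝ l (residual A b x)) - f x) '' X)

/-- The minimum `F*` of the dual function. -/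
def dualValue (A : Matrix (Fin N) (Fin d) ℝ) (b : E N) (X : Set (E d)) (f : E d → ℝ) : ℝ :=
  sInf (range (dualFn A b X f))

/-- The set `Λ*` of optimal Lagrange multipliers, i.e. of minimizers of the dual function. -/
def multipliers (A : Matrix (Fin N) (Fin d) ℝ) (b : E N) (X : Set (E d)) (f : E d → ℝ) :
    Set (E N) :=
  {l | ∀ l' : E N, dualFn A b X f l ≤ dualFn A b X f l'}

/-- The `δ`-sublevel set `{l : F(l) - F* ≤ δ}` of the dual function. -/
def sublevel (A : Matrix (Fin N) (Fin d) ℝ) (b : E N) (X : Set (E d)) (f : E d → ℝ)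
    (δ : ℝ) : Set (E N) :=
  {l | dualFn A b X f l - dualValue A b X f ≤ δ}

/-- The local error bound of the dual function with exponent `β`, level `δ`, constant `C`:
`Λ*` is nonempty and `dist(l, Λ*) ≤ C (F(l) - F*)^β` on the `δ`-sublevel set. -/
structure LocalErrorBound (A : Matrix (Fin N) (Fin d) ℝ) (b : E N) (X : Set (E d))
    (f : E d → ℝ) (β δ C : ℝ) : Prop where
  exponent_pos : 0 < β
  exponent_le_one : β ≤ 1
  level_pos : 0 < δ
  const_pos : 0 < C
  nonempty : (multipliers A b X f).Nonempty
  bound : ∀ l ∈ sublevel A b X f δ,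
    Metric.infDist l (multipliers A b X f) ≤ C * (dualFn A b X f l - dualValue A b X f) ^ β

/-- The orthogonal projection of `ℝᴺ` onto the column space of `A`. -/
def colProj (A : Matrix (Fin N) (Fin d) ℝ) (l : E N) : E N :=
  (LinearMap.range (Matrix.toEuclideanLin A)).starProjection l

/-- The largest eigenvalue of `Aᵀ A`. -/
def sigmaMax (A : Matrix (Fin N) (Fin d) ℝ) : ℝ :=
  sSup (spectrum ℝ (A.transpose * A))

/-- One maximization step: a maximizer over `X` of
`-⟨l, A x - b⟩ - f x - (μ/2) ‖x - c‖²` (unique for convex compact nonempty `X`, convex `f`,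
`μ > 0`). -/
def primalUpdate (A : Matrix (Fin N) (Fin d) ℝ) (b : E N) (X : Set (E d)) (f : E d → ℝ)
    (c : E d) (μ : ℝ) (l : E N) : E d :=
  Classical.epsilon fun x => x ∈ X ∧
    IsMaxOn (fun y => -(inner ℝ l (residual A b y)) - f y - μ / 2 * ‖y - c‖ ^ 2) X x

/-- The data kept by the primal-dual smoothing algorithm after `t` iterations. -/
structure PDSState (N d : ℕ) where
  /-- the multiplier `λ_t` -/
  cur : E N
  /-- the multiplier `λ_{t-1}` -/
  prev : E N
  /-- the parameter `θ_t` -/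
  theta : ℝ
  /-- the parameter `θ_{t-1}` -/
  thetaPrev : ℝ
  /-- `∑_{s < t} (1 / θ_s) x(λ̂_s)` -/
  weighted : E d
  /-- `S_t = ∑_{s < t} 1 / θ_s` -/
  weight : ℝ
  /-- the number of maximization steps performed -/
  steps : ℕ

/-- `λ_0 = λ_{-1} = l`, `θ_0 = θ_{-1} = 1`. -/
def pdsInit (l : E N) : PDSState N d where
  cur := l
  prev := l
  theta := 1
  thetaPrev := 1
  weighted := 0
  weight := 0
  steps := 0

/-- The tentative multiplier `λ̂_t = λ_t + θ_t (1/θ_{t-1} - 1) (λ_t - λ_{t-1})`. -/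
def tentative (s : PDSState N d) : E N :=
  s.cur + (s.theta * (s.thetaPrev⁻¹ - 1)) • (s.cur - s.prev)

/-- One iteration. The dual step length is `μ / σ_max(Aᵀ A)`, the reciprocal of the smoothness
modulus of the smoothed dual function. (If `A = 0` the step length is immaterial: the
residual of a feasible problem is then `0`.) -/
def pdsStep (A : Matrix (Fin N) (Fin d) ℝ) (b : E N) (X : Set (E d)) (f : E d → ℝ)
    (c : E d) (μ : ℝ) (s : PDSState N d) : PDSState N d where
  cur := tentative s
    + (μ / sigmaMax A) • residual A b (primalUpdate A b X f c μ (tentative s))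
  prev := s.cur
  theta := (√(s.theta ^ 4 + 4 * s.theta ^ 2) - s.theta ^ 2) / 2
  thetaPrev := s.theta
  weighted := s.weighted + s.theta⁻¹ • primalUpdate A b X f c μ (tentative s)
  weight := s.weight + s.theta⁻¹
  steps := s.steps + 1

/-- The primal-dual smoothing algorithm `PDS(l, c, μ, T)`, run for `T` iterations. -/
def pds (A : Matrix (Fin N) (Fin d) ℝ) (b : E N) (X : Set (E d)) (f : E d → ℝ)
    (l : E N) (c : E d) (μ : ℝ) : ℕ → PDSState N d
  | 0 => pdsInit l
  | t + 1 => pdsStep A b X f c μ (pds A b X f l c μ t)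

/-- The data kept by the homotopy method after `k` stages. -/
structure StageState (N d : ℕ) where
  /-- the multiplier `λ^(k)` -/
  dual : E N
  /-- the primal average of stage `k` -/
  primal : E d
  /-- the smoothing parameter `μ_k` -/
  mu : ℝ
  /-- the total number of maximization steps performed in the stages `1, …, k` -/
  steps : ℕ

/-- The homotopy method after `k` stages, each one a run of length `T` of the primal-dual
smoothing algorithm started at the output of the stage before, with `μ_k = μ_{k-1} / 2`,
`μ_0 = ε₀ / D²`, `λ^(0) = 0`. -/
def homotopy (A : Matrix (Fin N) (Fin d) ℝ) (b : E N) (X : Set (E d)) (f : E d → ℝ)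
    (D ε₀ : ℝ) (x₀ : E d) (T : ℕ) : ℕ → StageState N d
  | 0 => { dual := 0, primal := x₀, mu := ε₀ / D ^ 2, steps := 0 }
  | k + 1 =>
    let s := homotopy A b X f D ε₀ x₀ T k
    let r := pds A b X f s.dual s.primal (s.mu / 2) T
    { dual := r.cur
      primal := r.weight⁻¹ • r.weighted
      mu := s.mu / 2
      steps := s.steps + r.steps }

/-- The number of stages `⌈log₂(ε₀/ε)⌉ + 1`. -/
def numStages (ε₀ ε : ℝ) : ℕ := ⌈Real.logb 2 (ε₀ / ε)⌉₊ + 1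

/-- The lower bound `4 D C √σ_max(Aᵀ A) (2M)^{β/2} / ε^{2/(2+β)}` on the time horizon
of each stage. -/
def horizonBound (A : Matrix (Fin N) (Fin d) ℝ) (D M β C ε : ℝ) : ℝ :=
  4 * D * C * √(sigmaMax A) * (2 * M) ^ (β / 2) / ε ^ (2 / (2 + β))

/-- The smallest integer horizon `T ≥ 1` that respects the lower bound. -/
def minHorizon (A : Matrix (Fin N) (Fin d) ℝ) (D M β C ε : ℝ) : ℕ :=
  max 1 ⌈horizonBound A D M β C ε⌉₊

end Homotopy

end

/-!
Each maximization step evaluates the gradient of the smoothed dual function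
`Φ(l) = max_X (-⟨l, A y - b⟩ - f y - (μ/2) ‖y - c‖²)`, which is smooth with modulus `σ_max / μ`
because the proximal Lagrangian is strongly concave, and which satisfies
`F - μ D² / 2 ≤ Φ ≤ F`. The inner loop is Nesterov's accelerated method for `Φ`. Its estimate
sequence (`pds_estimate`) gives, for the weighted average `x̄` and the gain `γ = (μ / σ_max) S_T`,
`S_T ≥ T² / 4`,
`Φ(λ_T) ≤ -⟨λ_0, A x̄ - b⟩ - f x̄ - (μ/2) ‖x̄ - c‖² - (γ/2) ‖A x̄ - b‖²`   (`pds_bound`).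
Everything else is read off from this one inequality.

Compared with the value at a minimizer of `F`, it bounds `F(λ_T) - F*` by `μ D² / 2` plus the squared
distance of the projected starting multiplier to `ν*` over `2 γ`. The error bound, extended beyond
the `ε`-sublevel set by convexity (`norm_colProj_sub_le`), bounds that distance by the dual accuracy
of the stage before; with the prescribed horizon each stage then halves the dual accuracy, down to
`ε` (`homotopy_dual_le`).

In the stage after that, the inequality is compared with the value at a near-minimizer `l'` of `Φ`,
not of `F`. This leaves no smoothing error, so `‖A x̄ - b‖` is at most a multiple of the distance
between the projections of `λ_0` and `l'`, over `γ`; both lie within `C ε^β` of `ν*`, by the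
uniqueness of the projected minimizer (`norm_residual_le_of_bound`). The exponent `2 / (2 + β)`
suffices because `β + 4 / (2 + β) ≥ 2` (`rpow_mul_rpow_le_sq`). The primal accuracy follows from
weak duality and the size of the residual (`sub_primalValue_le_of_bound`).

If `A = 0`, all residuals of the feasible problem vanish; the estimates are kept free of division by
the step length, so that they hold in this case too.
-/

namespace Homotopy

variable {N d : ℕ} {A : Matrix (Fin N) (Fin d) ℝ} {b : E N} {X : Set (E d)} {f : E d → ℝ}

/-! ### The residual and the spectral bound -/

lemma residual_sub_residual (x y : E d) :
    residual A b x - residual A b y = Matrix.toEuclideanLin A (x - y) := by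
  simp [residual, map_sub]

lemma residual_combo {s t : ℝ} (h : s + t = 1) (x y : E d) :
    residual A b (s • x + t • y) = s • residual A b x + t • residual A b y := by
  obtain rfl : s = 1 - t := by linarith
  simp only [residual, map_add, map_smul]
  module

lemma continuous_residual : Continuous (residual A b) := by
  unfold residual
  have := (Matrix.toEuclideanLin A).continuous_of_finiteDimensional
  fun_prop

/-- If the constraint `A x = b` is solvable, residuals lie in the column space of `A`, so only
the component of a multiplier in that space is seen by the Lagrangian. -/
lemma inner_colProj_residual (hfeas : (feasibleSet A b X).Nonempty) (l : E N) (x : E d) :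
    inner ℝ (colProj A l) (residual A b x) = inner ℝ l (residual A b x) := by
  obtain ⟨z, -, hz⟩ := hfeas
  have hmem : residual A b x ∈ LinearMap.range (Matrix.toEuclideanLin A) :=
    ⟨x - z, by rw [← residual_sub_residual (b := b), hz, sub_zero]⟩
  rw [colProj, Submodule.inner_starProjection_left_eq_right,
    Submodule.starProjection_eq_self_iff.2 hmem]

/-- The largest eigenvalue of `Aᵀ A` is the square of the operator norm of `A`: the supremum of
the Rayleigh quotient of `Aᵀ A` is an eigenvalue. -/
lemma norm_toEuclideanLin_sq_le (v : E d) :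
    ‖Matrix.toEuclideanLin A v‖ ^ 2 ≤ sigmaMax A * ‖v‖ ^ 2 := by
  rcases eq_or_ne v 0 with rfl | hv
  · simp
  have : Nontrivial (E d) := ⟨v, 0, hv⟩
  set B := Matrix.toEuclideanLin A
  set S : E d →ₗ[ℝ] E d := LinearMap.adjoint B ∘ₗ B with hS
  have hinner : ∀ x, inner ℝ (S x) x = ‖B x‖ ^ 2 := fun x => by
    rw [hS, LinearMap.comp_apply, LinearMap.adjoint_inner_left, real_inner_self_eq_norm_sq]
  have hsymm : S.IsSymmetric := fun x y => by
    simp [hS, LinearMap.adjoint_inner_left, LinearMap.adjoint_inner_right]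
  have hSA : S = Matrix.toLpLin 2 2 (A.transpose * A) := by
    rw [Matrix.toLpLin_mul 2 2 2, hS, ← Matrix.toEuclideanLin_conjTranspose_eq_adjoint,
      Matrix.conjTranspose_eq_transpose_of_trivial]
  have heig := (hsymm.hasEigenvalue_iSup_of_finiteDimensional).mem_spectrum
  have hspec : spectrum ℝ S = spectrum ℝ (A.transpose * A) := by
    rw [hSA, Matrix.spectrum_toLpLin]
  rw [hspec] at heig
  have hfin : BddAbove (spectrum ℝ (A.transpose * A)) := by
    rw [← hspec]
    exact (Module.End.finite_spectrum S).bddAbove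
  have hle : ∀ x : E d, ‖B x‖ ^ 2 ≤ ‖LinearMap.toContinuousLinearMap B‖ ^ 2 * ‖x‖ ^ 2 := fun x => by
    rw [← mul_pow]
    gcongr
    exact (LinearMap.toContinuousLinearMap B).le_opNorm x
  have hbdd : BddAbove (range fun x : {x : E d // x ≠ 0} =>
      RCLike.re (inner ℝ (S x) (x : E d)) / ‖(x : E d)‖ ^ 2) := by
    refine ⟨‖LinearMap.toContinuousLinearMap B‖ ^ 2, ?_⟩
    rintro _ ⟨⟨x, hx⟩, rfl⟩
    have : 0 < ‖x‖ := norm_pos_iff.2 hx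
    simp only [hinner, RCLike.re_to_real]
    rw [div_le_iff₀ (by positivity)]
    exact hle x
  have h1 := le_ciSup hbdd ⟨v, hv⟩
  have h2 := h1.trans (le_csSup hfin heig)
  have : 0 < ‖v‖ := norm_pos_iff.2 hv
  simp only [hinner, RCLike.re_to_real] at h2
  rwa [div_le_iff₀ (by positivity)] at h2

lemma residual_eq_zero_of_sigmaMax_nonpos (hfeas : (feasibleSet A b X).Nonempty)
    (hσ : sigmaMax A ≤ 0) (x : E d) : residual A b x = 0 := by
  obtain ⟨z, -, hz⟩ := hfeas
  have h := norm_toEuclideanLin_sq_le (A := A) (x - z)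
  rw [← residual_sub_residual (b := b), hz, sub_zero] at h
  have h0 : ‖residual A b x‖ ^ 2 ≤ 0 :=
    h.trans (mul_nonpos_of_nonpos_of_nonneg hσ (sq_nonneg _))
  exact norm_eq_zero.1 (pow_eq_zero_iff two_ne_zero |>.1 (le_antisymm h0 (sq_nonneg _)))

lemma sigmaMax_nonneg [Nontrivial (E d)] : 0 ≤ sigmaMax A := by
  obtain ⟨v, hv⟩ := exists_ne (0 : E d)
  have : 0 < ‖v‖ := norm_pos_iff.2 hv
  exact nonneg_of_mul_nonneg_left ((sq_nonneg _).trans (norm_toEuclideanLin_sq_le (A := A) v))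
    (by positivity)

/-! ### The smoothed dual function -/

/-- The proximal Lagrangian `-⟨l, A y - b⟩ - f y - (μ/2) ‖y - c‖²`, maximized over `X` in each
step of the algorithm. For `μ = 0` it is the sign-flipped Lagrangian, whatever `c`. -/
noncomputable def proxObj (A : Matrix (Fin N) (Fin d) ℝ) (b : E N) (f : E d → ℝ) (c : E d) (μ : ℝ)
    (l : E N) (y : E d) : ℝ :=
  -(inner ℝ l (residual A b y)) - f y - μ / 2 * ‖y - c‖ ^ 2

/-- The smoothed dual function, the maximum over `X` of the proximal Lagrangian. -/
noncomputable def smoothDual (A : Matrix (Fin N) (Fin d) ℝ) (b : E N) (X : Set (E d)) (f : E d → ℝ)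
    (c : E d) (μ : ℝ) (l : E N) : ℝ :=
  sSup (proxObj A b f c μ l '' X)

lemma dualFn_eq_smoothDual (l : E N) (c : E d) :
    dualFn A b X f l = smoothDual A b X f c 0 l := by
  have : proxObj A b f c 0 l = fun x => -(inner ℝ l (residual A b x)) - f x :=
    funext fun y => by simp [proxObj]
  rw [smoothDual, this, dualFn]

lemma proxObj_le_smoothDual (hX : IsCompact X) (hf : ConvexOn ℝ univ f) (c : E d) (μ : ℝ)
    (l : E N) {y : E d} (hy : y ∈ X) : proxObj A b f c μ l y ≤ smoothDual A b X f c μ l := by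
  have hfc : Continuous f := continuousOn_univ.1 (hf.continuousOn isOpen_univ)
  have hc : Continuous (proxObj A b f c μ l) := by
    have := continuous_residual (A := A) (b := b)
    unfold proxObj
    fun_prop
  exact le_csSup (hX.image hc).bddAbove (mem_image_of_mem _ hy)

lemma smoothDual_le (hne : X.Nonempty) {c : E d} {μ : ℝ} {l : E N} {a : ℝ}
    (h : ∀ y ∈ X, proxObj A b f c μ l y ≤ a) : smoothDual A b X f c μ l ≤ a :=
  csSup_le (hne.image _) (forall_mem_image.2 h)

/-- The maximum defining a maximization step is attained. -/
lemma primalUpdate_spec (hX : IsCompact X) (hne : X.Nonempty) (hf : ConvexOn ℝ univ f) (c : E d)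
    (μ : ℝ) (l : E N) :
    primalUpdate A b X f c μ l ∈ X ∧
      ∀ y ∈ X, proxObj A b f c μ l y ≤ proxObj A b f c μ l (primalUpdate A b X f c μ l) := by
  have hfc : Continuous f := continuousOn_univ.1 (hf.continuousOn isOpen_univ)
  have hc : Continuous (proxObj A b f c μ l) := by
    have := continuous_residual (A := A) (b := b)
    unfold proxObj
    fun_prop
  exact Classical.epsilon_spec
    (p := fun x => x ∈ X ∧ IsMaxOn (proxObj A b f c μ l) X x) (hX.exists_isMaxOn hne hc.continuousOn)

/-- The proximal Lagrangian is strongly concave with modulus `μ`. -/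
lemma proxObj_combo (hf : ConvexOn ℝ univ f) (c : E d) (μ : ℝ) (l : E N) {s t : ℝ} (hs : 0 ≤ s)
    (ht : 0 ≤ t) (h : s + t = 1) (x y : E d) :
    s * proxObj A b f c μ l x + t * proxObj A b f c μ l y + μ / 2 * (s * t * ‖x - y‖ ^ 2)
      ≤ proxObj A b f c μ l (s • x + t • y) := by
  have hconv := hf.2 (mem_univ x) (mem_univ y) hs ht h
  simp only [smul_eq_mul] at hconv
  have hsq : ‖s • x + t • y - c‖ ^ 2 = s * ‖x - c‖ ^ 2 + t * ‖y - c‖ ^ 2 - s * t * ‖x - y‖ ^ 2 := by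
    obtain rfl : s = 1 - t := by linarith
    have h1 : (1 - t) • x + t • y - c = (x - c) - t • (x - y) := by module
    have h2 : y - c = (x - c) - (x - y) := by abel
    rw [h1, h2, norm_sub_sq_real (x - c) (t • (x - y)), norm_sub_sq_real (x - c) (x - y),
      norm_smul, inner_smul_right, mul_pow, Real.norm_eq_abs, sq_abs]
    ring
  simp only [proxObj, residual_combo h, inner_add_right, inner_smul_right, hsq]
  linarith

lemma proxObj_add_le_of_isMax (hXc : Convex ℝ X) (hf : ConvexOn ℝ univ f) {c : E d} {μ : ℝ}
    {l : E N} {x : E d} (hx : x ∈ X) (hmax : ∀ y ∈ X, proxObj A b f c μ l y ≤ proxObj A b f c μ l x)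
    {y : E d} (hy : y ∈ X) :
    proxObj A b f c μ l y + μ / 2 * ‖x - y‖ ^ 2 ≤ proxObj A b f c μ l x := by
  have key : ∀ t ∈ Ioo (0 : ℝ) 1,
      proxObj A b f c μ l y + μ / 2 * ((1 - t) * ‖x - y‖ ^ 2) ≤ proxObj A b f c μ l x := by
    rintro t ⟨h0, h1⟩
    have h2 := proxObj_combo (A := A) (b := b) hf c μ l (sub_nonneg.2 h1.le) h0.le (by ring) x y
    have h3 := hmax _ (hXc hx hy (sub_nonneg.2 h1.le) h0.le (by ring))
    nlinarith
  have hlim : Tendsto (fun t : ℝ => proxObj A b f c μ l y + μ / 2 * ((1 - t) * ‖x - y‖ ^ 2))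
      (𝓝[>] 0) (𝓝 (proxObj A b f c μ l y + μ / 2 * ((1 - 0) * ‖x - y‖ ^ 2))) :=
    Tendsto.mono_left (Continuous.tendsto (by fun_prop) _) nhdsWithin_le_nhds
  rw [sub_zero, one_mul] at hlim
  exact le_of_tendsto hlim (by
    filter_upwards [Ioo_mem_nhdsGT (zero_lt_one' ℝ)] with t ht using key t ht)

lemma smoothDual_eq_primalUpdate (hX : IsCompact X) (hne : X.Nonempty) (hf : ConvexOn ℝ univ f)
    (c : E d) (μ : ℝ) (l : E N) :
    smoothDual A b X f c μ l = proxObj A b f c μ l (primalUpdate A b X f c μ l) :=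
  have h := primalUpdate_spec (A := A) (b := b) hX hne hf c μ l
  le_antisymm (smoothDual_le hne h.2) (proxObj_le_smoothDual hX hf c μ l h.1)

lemma proxObj_shift (c : E d) (μ : ℝ) (l l' : E N) (y : E d) :
    proxObj A b f c μ l' y = proxObj A b f c μ l y - inner ℝ (l' - l) (residual A b y) := by
  simp only [proxObj, inner_sub_left]
  ring

/-- A dual step of length `μ / σ_max` along the negative gradient of the smoothed dual function
decreases it by the amount its smoothness promises. -/
lemma smoothDual_step_le (hX : IsCompact X) (hXc : Convex ℝ X) (hne : X.Nonempty)
    (hf : ConvexOn ℝ univ f) (hσ : 0 ≤ sigmaMax A) (c : E d) {μ : ℝ} (hμ : 0 ≤ μ) (l : E N) :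
    smoothDual A b X f c μ
        (l + (μ / sigmaMax A) • residual A b (primalUpdate A b X f c μ l))
      ≤ smoothDual A b X f c μ l
        - μ / sigmaMax A / 2 * ‖residual A b (primalUpdate A b X f c μ l)‖ ^ 2 := by
  set x := primalUpdate A b X f c μ l with hx
  obtain ⟨hxX, hmax⟩ := primalUpdate_spec (A := A) (b := b) hX hne hf c μ l
  rw [← hx] at hxX hmax
  set α := μ / sigmaMax A with hα
  have hα0 : 0 ≤ α := div_nonneg hμ hσ
  refine smoothDual_le hne fun y hy => ?_
  have hstrong := proxObj_add_le_of_isMax hXc hf hxX hmax hy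
  have hle := proxObj_le_smoothDual (A := A) (b := b) hX hf c μ l hxX
  set r := residual A b x
  set v := r - residual A b y with hv
  have hvx : v = Matrix.toEuclideanLin A (x - y) := residual_sub_residual x y
  have hnorm : α * ‖v‖ ^ 2 ≤ μ * ‖x - y‖ ^ 2 := by
    rcases hσ.eq_or_lt with h0 | h0
    · rw [hα, ← h0, div_zero, zero_mul]
      positivity
    · have := norm_toEuclideanLin_sq_le (A := A) (x - y)
      rw [← hvx] at this
      calc α * ‖v‖ ^ 2 ≤ α * (sigmaMax A * ‖x - y‖ ^ 2) := by gcongr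
        _ = μ * ‖x - y‖ ^ 2 := by rw [hα]; field_simp
  have hry : residual A b y = r - v := by rw [hv]; abel
  have hsq : 0 ≤ α * ‖r - v‖ ^ 2 := by positivity
  rw [norm_sub_sq_real] at hsq
  rw [proxObj_shift c μ l, add_sub_cancel_left, inner_smul_left, hry, inner_sub_right,
    real_inner_self_eq_norm_sq]
  simp only [conj_trivial]
  linarith

/-! ### The accelerated inner loop -/

/-- Along the recursion `θ' = (√(θ⁴ + 4θ²) - θ²) / 2` one has `θ'² = θ² (1 - θ')`. -/
lemma theta_step {θ : ℝ} (h0 : 0 < θ) :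
    let θ' := (√(θ ^ 4 + 4 * θ ^ 2) - θ ^ 2) / 2
    0 < θ' ∧ θ' ≤ 1 ∧ θ' ^ 2 = θ ^ 2 * (1 - θ') := by
  intro θ'
  have hs : √(θ ^ 4 + 4 * θ ^ 2) ^ 2 = θ ^ 4 + 4 * θ ^ 2 := Real.sq_sqrt (by positivity)
  have hsθ : √(θ ^ 4 + 4 * θ ^ 2) = 2 * θ' + θ ^ 2 := by simp only [θ']; ring
  have hlt : θ ^ 2 < √(θ ^ 4 + 4 * θ ^ 2) := Real.lt_sqrt_of_sq_lt (by nlinarith [sq_pos_of_pos h0])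
  have hpos : 0 < θ' := by simp only [θ']; linarith
  have heq : θ' ^ 2 = θ ^ 2 * (1 - θ') := by rw [hsθ] at hs; linarith
  refine ⟨hpos, ?_, heq⟩
  have h2 : 0 < θ ^ 2 * (1 - θ') := heq ▸ by positivity
  have := pos_of_mul_pos_right h2 (sq_nonneg θ)
  linarith

lemma pds_steps (l : E N) (c : E d) (μ : ℝ) (T : ℕ) : (pds A b X f l c μ T).steps = T := by
  induction T with
  | zero => rfl
  | succ t ih => simp [pds, pdsStep, ih]

/-- The weights `1 / θ_s` add up to `(1 - θ_t) / θ_t²`, which grows at least like `t² / 4`. -/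
lemma pds_weight (l : E N) (c : E d) (μ : ℝ) (t : ℕ) :
    let s := pds A b X f l c μ t
    0 < s.theta ∧ s.theta ≤ 1 ∧ s.weight * s.theta ^ 2 = 1 - s.theta ∧
      (t : ℝ) ^ 2 / 4 ≤ s.weight := by
  induction t with
  | zero => simp [pds, pdsInit]
  | succ t ih =>
    obtain ⟨h0, h1, hS, ht⟩ := ih
    set s := pds A b X f l c μ t
    obtain ⟨h0', h1', heq⟩ := theta_step h0
    refine ⟨h0', h1', ?_, ?_⟩
    · change (s.weight + s.theta⁻¹) * ((√(s.theta ^ 4 + 4 * s.theta ^ 2) - s.theta ^ 2) / 2) ^ 2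
        = 1 - (√(s.theta ^ 4 + 4 * s.theta ^ 2) - s.theta ^ 2) / 2
      have hw : (s.weight + s.theta⁻¹) * s.theta ^ 2 = 1 := by
        rw [add_mul, hS]; field_simp; ring
      rw [heq, ← mul_assoc, hw, one_mul]
    · change ((t + 1 : ℕ) : ℝ) ^ 2 / 4 ≤ s.weight + s.theta⁻¹
      set w := s.theta⁻¹ with hw
      have hwpos : 1 ≤ w := (one_le_inv₀ h0).2 h1
      have hSw : s.weight = w ^ 2 - w := by
        rw [hw]; field_simp; exact hS
      rw [hSw] at ht ⊢
      have ht0 : (0 : ℝ) ≤ t := t.cast_nonneg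
      have : ((t : ℝ) + 1) / 2 ≤ w := by nlinarith
      push_cast
      nlinarith

/-- The averages are convex combinations of the maximizers. -/
lemma pds_average_mem (hX : IsCompact X) (hXc : Convex ℝ X) (hne : X.Nonempty)
    (hf : ConvexOn ℝ univ f) (l : E N) (c : E d) (μ : ℝ) (t : ℕ) (ht : 1 ≤ t) :
    (pds A b X f l c μ t).weight⁻¹ • (pds A b X f l c μ t).weighted ∈ X := by
  induction t, ht using Nat.le_induction with
  | base =>
    have := (primalUpdate_spec (A := A) (b := b) hX hne hf c μ (tentative (pdsInit (d := d) l))).1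
    simpa [pds, pdsStep, pdsInit] using this
  | succ t ht ih =>
    obtain ⟨h0, -, -, hS⟩ := pds_weight (A := A) (b := b) (X := X) (f := f) l c μ t
    set s := pds A b X f l c μ t
    have hSpos : 0 < s.weight := by
      have : (1 : ℝ) ≤ t := by exact_mod_cast ht
      nlinarith
    have hx := (primalUpdate_spec (A := A) (b := b) hX hne hf c μ (tentative s)).1
    change (s.weight + s.theta⁻¹)⁻¹ • (s.weighted + s.theta⁻¹ • _) ∈ X
    have hW : 0 < s.weight + s.theta⁻¹ := by positivity
    convert hXc ih hx (a := s.weight / (s.weight + s.theta⁻¹))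
      (b := s.theta⁻¹ / (s.weight + s.theta⁻¹)) (by positivity) (by positivity) (by field_simp)
      using 1
    rw [smul_smul, smul_add, smul_smul]
    congr 2 <;> field_simp

/-- The extrapolation sequence `z_t = λ_{t-1} + θ_{t-1}⁻¹ (λ_t - λ_{t-1})` of the accelerated
method collects the weighted residuals. -/
lemma pds_extrapolation (l : E N) (c : E d) (μ : ℝ) (t : ℕ) :
    let s := pds A b X f l c μ t
    s.prev + s.thetaPrev⁻¹ • (s.cur - s.prev)
      = l + (μ / sigmaMax A) • (Matrix.toEuclideanLin A s.weighted - s.weight • b) := by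
  induction t with
  | zero => simp [pds, pdsInit]
  | succ t ih =>
    have h0 := (pds_weight (A := A) (b := b) (X := X) (f := f) l c μ t).1
    set s := pds A b X f l c μ t with hs
    simp only at ih
    set x := primalUpdate A b X f c μ (tentative s) with hx
    change s.cur + s.theta⁻¹ • (tentative s + (μ / sigmaMax A) • residual A b x - s.cur)
      = l + (μ / sigmaMax A) • (Matrix.toEuclideanLin A (s.weighted + s.theta⁻¹ • x)
          - (s.weight + s.theta⁻¹) • b)
    have h1 : l + (μ / sigmaMax A) • (Matrix.toEuclideanLin A (s.weighted + s.theta⁻¹ • x)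
          - (s.weight + s.theta⁻¹) • b)
        = (l + (μ / sigmaMax A) • (Matrix.toEuclideanLin A s.weighted - s.weight • b))
          + (s.theta⁻¹ * (μ / sigmaMax A)) • residual A b x := by
      simp only [residual, map_add, map_smul]
      module
    rw [h1, ← ih, tentative]
    match_scalars <;> field_simp <;> ring

/-- The estimate sequence of the accelerated method. It is phrased with the weighted average and
without dividing by the step length, so that it also covers `A = 0`. -/
lemma pds_estimate (hX : IsCompact X) (hXc : Convex ℝ X) (hne : X.Nonempty)
    (hf : ConvexOn ℝ univ f) (hσ : 0 ≤ sigmaMax A) (l : E N) (c : E d) {μ : ℝ} (hμ : 0 ≤ μ)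
    (t : ℕ) :
    let s := pds A b X f l c μ t
    s.weight * smoothDual A b X f c μ s.cur
      ≤ s.weight * proxObj A b f c μ l (s.weight⁻¹ • s.weighted)
        - μ / sigmaMax A / 2 * ‖Matrix.toEuclideanLin A s.weighted - s.weight • b‖ ^ 2 := by
  induction t with
  | zero => simp [pds, pdsInit]
  | succ t ih =>
    obtain ⟨h0, h1, hS, hSt⟩ := pds_weight (A := A) (b := b) (X := X) (f := f) l c μ t
    have hz := pds_extrapolation (A := A) (b := b) (X := X) (f := f) l c μ t
    set s := pds A b X f l c μ t with hs
    simp only at ih hz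
    obtain ⟨hxX, -⟩ := primalUpdate_spec (A := A) (b := b) hX hne hf c μ (tentative s)
    have hval := smoothDual_eq_primalUpdate (A := A) (b := b) hX hne hf c μ (tentative s)
    have hdesc := smoothDual_step_le (A := A) (b := b) hX hXc hne hf hσ c hμ (tentative s)
    set x := primalUpdate A b X f c μ (tentative s) with hx
    set α := μ / sigmaMax A
    set R := Matrix.toEuclideanLin A s.weighted - s.weight • b
    set r := residual A b x
    set w := s.theta⁻¹ with hw
    have hw0 : 0 < w := inv_pos.2 h0
    have hS0 : 0 ≤ s.weight := le_trans (by positivity) hSt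
    have hSw : s.weight = w ^ 2 - w := by rw [hw]; field_simp; exact hS
    have hWpos : 0 < s.weight + w := by positivity
    change (s.weight + w) * smoothDual A b X f c μ (tentative s + α • r)
      ≤ (s.weight + w) * proxObj A b f c μ l ((s.weight + w)⁻¹ • (s.weighted + w • x))
        - α / 2 * ‖Matrix.toEuclideanLin A (s.weighted + w • x) - (s.weight + w) • b‖ ^ 2
    have hR : Matrix.toEuclideanLin A (s.weighted + w • x) - (s.weight + w) • b = R + w • r := by
      simp only [R, r, residual, map_add, map_smul]
      module
    -- concavity of the proximal Lagrangian carries the averages along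
    have hconc : s.weight * proxObj A b f c μ l (s.weight⁻¹ • s.weighted)
        + w * proxObj A b f c μ l x
        ≤ (s.weight + w) * proxObj A b f c μ l ((s.weight + w)⁻¹ • (s.weighted + w • x)) := by
      have hp := proxObj_combo (A := A) (b := b) hf c μ l (s := s.weight / (s.weight + w))
        (t := w / (s.weight + w)) (by positivity) (by positivity) (by field_simp)
        (s.weight⁻¹ • s.weighted) x
      have hcomb : (s.weight / (s.weight + w)) • s.weight⁻¹ • s.weighted
          + (w / (s.weight + w)) • x = (s.weight + w)⁻¹ • (s.weighted + w • x) := by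
        rcases hS0.eq_or_lt with h | h
        · -- a zero weight sum occurs only before the first iteration, where nothing is collected
          have hwt : s.weighted = 0 := by
            rcases Nat.eq_zero_or_pos t with rfl | htpos
            · rfl
            · have : (1 : ℝ) ≤ t := by exact_mod_cast htpos
              nlinarith
          rw [hwt, ← h]
          simp [smul_smul, div_eq_inv_mul]
        · rw [smul_smul, smul_add, smul_smul]
          congr 2 <;> field_simp
      rw [hcomb] at hp
      have hnn : 0 ≤ μ / 2 * (s.weight / (s.weight + w) * (w / (s.weight + w))
          * ‖s.weight⁻¹ • s.weighted - x‖ ^ 2) := by positivity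
      calc _ = (s.weight + w) * (s.weight / (s.weight + w)
            * proxObj A b f c μ l (s.weight⁻¹ • s.weighted)
            + w / (s.weight + w) * proxObj A b f c μ l x) := by field_simp
        _ ≤ _ := by gcongr; linarith
    have hcur := proxObj_le_smoothDual (A := A) (b := b) hX hf c μ s.cur hxX
    rw [proxObj_shift c μ (tentative s), ← hval] at hcur
    have hlin : proxObj A b f c μ l x
        = smoothDual A b X f c μ (tentative s) - inner ℝ (l - tentative s) r := by
      rw [proxObj_shift c μ (tentative s), ← hval]
    -- the tentative multiplier is `(1 - θ_t) λ_t + θ_t z_t`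
    have htent : s.weight • (s.cur - tentative s) + w • (l - tentative s) = -((w * α) • R) := by
      have hl : l = s.prev + s.thetaPrev⁻¹ • (s.cur - s.prev) - α • R := by rw [hz]; abel
      rw [hl, hSw, tentative, hw]
      match_scalars <;> field_simp <;> ring
    have hinner : s.weight * inner ℝ (s.cur - tentative s) r + w * inner ℝ (l - tentative s) r
        = -(w * α * inner ℝ R r) := by
      have := congrArg (fun u => inner ℝ u r) htent
      simpa only [inner_add_left, inner_smul_left, inner_neg_left, conj_trivial] using this
    rw [hR, norm_add_sq_real, norm_smul, inner_smul_right, Real.norm_of_nonneg hw0.le, mul_pow]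
    have e1 : (s.weight + w) * smoothDual A b X f c μ (tentative s + α • r)
        ≤ (s.weight + w) * (smoothDual A b X f c μ (tentative s) - α / 2 * ‖r‖ ^ 2) := by gcongr
    have e2 := mul_le_mul_of_nonneg_left hcur hS0
    have e3 : (s.weight + w) * (α / 2 * ‖r‖ ^ 2) = α / 2 * (w ^ 2 * ‖r‖ ^ 2) := by
      rw [hSw]; ring
    rw [hlin] at hconc
    linarith

/-- The outcome of the inner loop: with `x̄` the weighted average and `S ≥ T² / 4` the weight sum,
the smoothed dual value at the last multiplier is bounded by the proximal Lagrangian at `x̄`, with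
a gain proportional to the squared residual of `x̄`. -/
lemma pds_bound (hX : IsCompact X) (hXc : Convex ℝ X) (hne : X.Nonempty)
    (hf : ConvexOn ℝ univ f) (hσ : 0 ≤ sigmaMax A) (l : E N) (c : E d) {μ : ℝ} (hμ : 0 ≤ μ)
    {T : ℕ} (hT : 1 ≤ T) :
    let s := pds A b X f l c μ T
    smoothDual A b X f c μ s.cur
      ≤ proxObj A b f c μ l (s.weight⁻¹ • s.weighted)
        - μ / sigmaMax A * s.weight / 2 * ‖residual A b (s.weight⁻¹ • s.weighted)‖ ^ 2 := by
  intro s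
  have h := pds_estimate (A := A) (b := b) hX hXc hne hf hσ l c hμ T
  have hS := (pds_weight (A := A) (b := b) (X := X) (f := f) l c μ T).2.2.2
  change (T : ℝ) ^ 2 / 4 ≤ s.weight at hS
  simp only at h
  change s.weight * smoothDual A b X f c μ s.cur ≤
    s.weight * proxObj A b f c μ l (s.weight⁻¹ • s.weighted)
        - μ / sigmaMax A / 2 * ‖Matrix.toEuclideanLin A s.weighted - s.weight • b‖ ^ 2 at h
  have hT1 : (1 : ℝ) ≤ T := by exact_mod_cast hT
  have hSpos : 0 < s.weight := by nlinarith
  have hR : Matrix.toEuclideanLin A s.weighted - s.weight • b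
      = s.weight • residual A b (s.weight⁻¹ • s.weighted) := by
    rw [residual, map_smul, smul_sub, smul_inv_smul₀ hSpos.ne']
  rw [hR, norm_smul, Real.norm_of_nonneg hSpos.le] at h
  refine le_of_mul_le_mul_left (h.trans_eq ?_) hSpos
  ring

/-! ### The dual function and its error bound -/

lemma dualValue_eq {l : E N} (hl : l ∈ multipliers A b X f) :
    dualValue A b X f = dualFn A b X f l :=
  IsLeast.csInf_eq ⟨mem_range_self l, forall_mem_range.2 hl⟩

lemma dualFn_combo_le (hX : IsCompact X) (hne : X.Nonempty) (hf : ConvexOn ℝ univ f) {s t : ℝ}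
    (hs : 0 ≤ s) (ht : 0 ≤ t) (h : s + t = 1) (l l' : E N) :
    dualFn A b X f (s • l + t • l') ≤ s * dualFn A b X f l + t * dualFn A b X f l' := by
  simp only [dualFn_eq_smoothDual _ (0 : E d)]
  refine smoothDual_le hne fun y hy => ?_
  have h1 := mul_le_mul_of_nonneg_left
    (proxObj_le_smoothDual (A := A) (b := b) hX hf 0 0 l hy) hs
  have h2 := mul_le_mul_of_nonneg_left
    (proxObj_le_smoothDual (A := A) (b := b) hX hf 0 0 l' hy) ht
  refine le_trans (le_of_eq ?_) (add_le_add h1 h2)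
  obtain rfl : s = 1 - t := by linarith
  simp only [proxObj, inner_add_left, inner_smul_left, conj_trivial]
  ring

lemma smoothDual_le_dualFn (hX : IsCompact X) (hne : X.Nonempty) (hf : ConvexOn ℝ univ f)
    (c : E d) {μ : ℝ} (hμ : 0 ≤ μ) (l : E N) :
    smoothDual A b X f c μ l ≤ dualFn A b X f l := by
  rw [dualFn_eq_smoothDual l c]
  refine smoothDual_le hne fun y hy => le_trans ?_ (proxObj_le_smoothDual hX hf c 0 l hy)
  have : 0 ≤ μ / 2 * ‖y - c‖ ^ 2 := by positivity
  simp only [proxObj]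
  linarith

lemma dualFn_le_smoothDual_add (hX : IsCompact X) (hf : ConvexOn ℝ univ f) {c : E d} (hc : c ∈ X)
    {μ D : ℝ} (hμ : 0 ≤ μ) (hdiam : ∀ x ∈ X, ∀ y ∈ X, ‖x - y‖ ≤ D) (l : E N) :
    dualFn A b X f l ≤ smoothDual A b X f c μ l + μ * D ^ 2 / 2 := by
  rw [dualFn_eq_smoothDual l c]
  refine smoothDual_le ⟨c, hc⟩ fun y hy => ?_
  have h1 := proxObj_le_smoothDual (A := A) (b := b) hX hf c μ l hy
  have h2 : μ / 2 * ‖y - c‖ ^ 2 ≤ μ / 2 * D ^ 2 := by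
    have := hdiam y hy c hc
    gcongr
  simp only [proxObj] at h1 ⊢
  linarith

/-- Weak duality, for the smoothed dual function. -/
lemma neg_le_smoothDual (hX : IsCompact X) (hf : ConvexOn ℝ univ f) {c : E d} (hc : c ∈ X)
    {μ D : ℝ} (hμ : 0 ≤ μ) (hdiam : ∀ x ∈ X, ∀ y ∈ X, ‖x - y‖ ≤ D) {x : E d}
    (hx : x ∈ feasibleSet A b X) (l : E N) :
    -f x - μ * D ^ 2 / 2 ≤ smoothDual A b X f c μ l := by
  have h1 := proxObj_le_smoothDual (A := A) (b := b) hX hf c μ l hx.1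
  have h2 : μ / 2 * ‖x - c‖ ^ 2 ≤ μ / 2 * D ^ 2 := by
    have := hdiam x hx.1 c hc
    gcongr
  simp only [proxObj, hx.2, inner_zero_right] at h1
  linarith

/-- The error bound controls the distance of the projected multiplier to `ν`. Outside the
`ε`-sublevel set it is extended by convexity: the point of the segment to a minimizer at which
the error bound with level `ε` applies scales that distance linearly, since `ν` is the common
projection of all minimizers. -/
lemma norm_colProj_sub_le (hX : IsCompact X) (hne : X.Nonempty) (hf : ConvexOn ℝ univ f)
    {β δ C ε e : ℝ} (hleb : LocalErrorBound A b X f β δ C) {ν : E N}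
    (hν : ∀ l ∈ multipliers A b X f, colProj A l = ν) (hε : 0 < ε) (hεδ : ε ≤ δ) (hεe : ε ≤ e)
    {l : E N} (hl : dualFn A b X f l - dualValue A b X f ≤ e) :
    ‖colProj A l - ν‖ ≤ C * ε ^ β * (e / ε) := by
  have hC := hleb.const_pos
  have near : ∀ l' : E N, dualFn A b X f l' - dualValue A b X f ≤ ε →
      ‖colProj A l' - ν‖ ≤ C * ε ^ β := by
    intro l' hl'
    have h1 : ‖colProj A l' - ν‖ ≤ Metric.infDist l' (multipliers A b X f) := by
      refine (Metric.le_infDist hleb.nonempty).2 fun l₀ h₀ => ?_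
      rw [← hν l₀ h₀, dist_eq_norm, colProj, colProj, ← map_sub]
      exact Submodule.norm_starProjection_apply_le _ _
    refine (h1.trans (hleb.bound l' (hl'.trans hεδ))).trans ?_
    obtain ⟨l₀, h₀⟩ := hleb.nonempty
    have hnn : 0 ≤ dualFn A b X f l' - dualValue A b X f := by
      rw [dualValue_eq h₀]
      exact sub_nonneg.2 (h₀ l')
    have := hleb.exponent_pos.le
    gcongr
  obtain ⟨l₀, h₀⟩ := hleb.nonempty
  have hF₀ := dualValue_eq h₀
  have he : 0 < e := hε.trans_le hεe
  set t := ε / e with ht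
  have ht0 : 0 < t := by positivity
  have ht1 : t ≤ 1 := (div_le_one he).2 hεe
  have hconv := dualFn_combo_le (A := A) (b := b) hX hne hf (sub_nonneg.2 ht1) ht0.le (by ring) l₀ l
  rw [← hF₀] at hconv
  have h2 := near ((1 - t) • l₀ + t • l) (by
    have : t * (dualFn A b X f l - dualValue A b X f) ≤ t * e := by gcongr
    have hte : t * e = ε := by rw [ht]; field_simp
    linarith)
  have h3 : colProj A ((1 - t) • l₀ + t • l) - ν = t • (colProj A l - ν) := by
    have : colProj A ((1 - t) • l₀ + t • l) = (1 - t) • colProj A l₀ + t • colProj A l := by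
      simp only [colProj, map_add, map_smul]
    rw [this, hν l₀ h₀]
    module
  rw [h3, norm_smul, Real.norm_of_nonneg ht0.le] at h2
  have h4 : e / ε = t⁻¹ := by rw [ht, inv_div]
  rw [h4, ← div_eq_mul_inv, le_div_iff₀ ht0]
  linarith

/-! ### One stage -/

lemma inner_residual_le (hfeas : (feasibleSet A b X).Nonempty) (l : E N) (x : E d) :
    inner ℝ l (residual A b x) ≤ ‖colProj A l‖ * ‖residual A b x‖ := by
  rw [← inner_colProj_residual hfeas l x]
  exact real_inner_le_norm _ _

lemma colProj_sub (l l' : E N) : colProj A (l - l') = colProj A l - colProj A l' := by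
  simp only [colProj, map_sub]

/-- If the proximal Lagrangian at `x` exceeds the smoothed dual value at `l₁` by a multiple of the
squared residual of `x`, then so does, up to a linear term in the residual, the smoothed dual value
at any `l'`: changing the multiplier changes the proximal Lagrangian only by an inner product with
the residual. -/
lemma smoothDual_le_add_of_bound (hX : IsCompact X) (hf : ConvexOn ℝ univ f)
    (hfeas : (feasibleSet A b X).Nonempty) {c x : E d} (hx : x ∈ X) {μ γ : ℝ} {l l₁ : E N}
    (h : smoothDual A b X f c μ l₁
      ≤ proxObj A b f c μ l x - γ / 2 * ‖residual A b x‖ ^ 2) (l' : E N) :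
    smoothDual A b X f c μ l₁ ≤ smoothDual A b X f c μ l'
      + ‖colProj A l' - colProj A l‖ * ‖residual A b x‖ - γ / 2 * ‖residual A b x‖ ^ 2 := by
  have h1 := proxObj_le_smoothDual (A := A) (b := b) hX hf c μ l' hx
  rw [proxObj_shift c μ l] at h1
  have h2 := inner_residual_le (A := A) (b := b) hfeas (l' - l) x
  rw [colProj_sub] at h2
  linarith

/-- Dual progress of a stage. -/
lemma dualFn_sub_le_of_bound (hX : IsCompact X) (hf : ConvexOn ℝ univ f)
    (hfeas : (feasibleSet A b X).Nonempty) {c x : E d} (hc : c ∈ X) (hx : x ∈ X) {μ γ D : ℝ}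
    (hμ : 0 ≤ μ) (hdiam : ∀ x ∈ X, ∀ y ∈ X, ‖x - y‖ ≤ D) {l l₁ l₀ : E N}
    (h : smoothDual A b X f c μ l₁
      ≤ proxObj A b f c μ l x - γ / 2 * ‖residual A b x‖ ^ 2)
    (hl₀ : l₀ ∈ multipliers A b X f) {p : ℝ} (hp : ‖colProj A l - colProj A l₀‖ ≤ p)
    (hγ : residual A b x = 0 ∨ 0 < γ ∧ p ^ 2 ≤ γ * (μ * D ^ 2)) :
    dualFn A b X f l₁ - dualValue A b X f ≤ μ * D ^ 2 := by
  have h1 := smoothDual_le_add_of_bound hX hf hfeas hx h l₀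
  have h2 := smoothDual_le_dualFn (A := A) (b := b) hX ⟨c, hc⟩ hf c hμ l₀
  have h3 := dualFn_le_smoothDual_add (A := A) (b := b) hX hf hc hμ hdiam l₁
  rw [dualValue_eq hl₀]
  rw [norm_sub_rev] at hp
  set y := ‖residual A b x‖ with hy
  have hy0 : 0 ≤ y := norm_nonneg _
  have h4 : ‖colProj A l₀ - colProj A l‖ * y ≤ p * y := by gcongr
  have h5 : p * y - γ / 2 * y ^ 2 ≤ μ * D ^ 2 / 2 := by
    -- in the nondegenerate case, maximize the quadratic in `y`
    rcases hγ with h0 | ⟨hγ0, hpγ⟩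
    · rw [hy, h0, norm_zero]
      have : 0 ≤ μ * D ^ 2 := by positivity
      linarith
    · refine le_of_mul_le_mul_left ?_ hγ0
      nlinarith [sq_nonneg (p - γ * y)]
  linarith

/-- Size of the residual after a stage. The reference point is a near-minimizer `l'` of the
smoothed dual function: compared with it, smoothing costs nothing, and it is also a near-minimizer
of the dual function, so the error bound applies to it. -/
lemma norm_residual_le_of_bound (hX : IsCompact X) (hf : ConvexOn ℝ univ f)
    (hfeas : (feasibleSet A b X).Nonempty) {c x : E d} (hc : c ∈ X) (hx : x ∈ X) {μ γ D : ℝ}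
    (hμ : 0 ≤ μ) (hdiam : ∀ x ∈ X, ∀ y ∈ X, ‖x - y‖ ≤ D) {l l₁ : E N}
    (h : smoothDual A b X f c μ l₁
      ≤ proxObj A b f c μ l x - γ / 2 * ‖residual A b x‖ ^ 2)
    {β δ C ε : ℝ} (hleb : LocalErrorBound A b X f β δ C) {ν : E N}
    (hν : ∀ l ∈ multipliers A b X f, colProj A l = ν) (hε : 0 < ε) (hεδ : ε ≤ δ)
    (hμε : μ * D ^ 2 ≤ ε) (hl : ‖colProj A l - ν‖ ≤ C * ε ^ β) (hγ : 0 < γ) :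
    ‖residual A b x‖ ≤ 4 * (C * ε ^ β) / γ := by
  -- near-minimizers of every precision `η` are used, so that none need be exact
  set y := ‖residual A b x‖
  have hy0 : 0 ≤ y := norm_nonneg _
  set B := C * ε ^ β with hB
  obtain ⟨l₀, hl₀⟩ := hleb.nonempty
  have hbdd : BddBelow (range (smoothDual A b X f c μ)) := by
    obtain ⟨z, hz⟩ := hfeas
    exact ⟨_, forall_mem_range.2 fun l' => neg_le_smoothDual hX hf hc hμ hdiam hz l'⟩
  have key : ∀ η : ℝ, 0 < η → η ≤ ε / 2 → γ / 2 * y ^ 2 ≤ 2 * B * y + η := by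
    intro η hη hηε
    obtain ⟨_, ⟨l', rfl⟩, hl'⟩ := exists_lt_of_csInf_lt (range_nonempty (smoothDual A b X f c μ))
      (lt_add_of_pos_right _ hη)
    have hmin : ∀ l'', smoothDual A b X f c μ l' ≤ smoothDual A b X f c μ l'' + η := fun l'' =>
      hl'.le.trans (by gcongr; exact csInf_le hbdd (mem_range_self l''))
    have h1 := smoothDual_le_add_of_bound hX hf hfeas hx h l'
    have h2 := hmin l₁
    have h3 := dualFn_le_smoothDual_add (A := A) (b := b) hX hf hc hμ hdiam l'
    have h4 := smoothDual_le_dualFn (A := A) (b := b) hX ⟨c, hc⟩ hf c hμ l₀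
    have h5 : ‖colProj A l' - ν‖ ≤ B := by
      have := norm_colProj_sub_le hX ⟨c, hc⟩ hf hleb hν hε hεδ le_rfl (l := l')
        (by rw [dualValue_eq hl₀]; linarith [hmin l₀])
      rwa [div_self hε.ne', mul_one] at this
    have h6 : ‖colProj A l' - colProj A l‖ ≤ 2 * B := by
      calc _ = ‖(colProj A l' - ν) - (colProj A l - ν)‖ := by rw [sub_sub_sub_cancel_right]
        _ ≤ ‖colProj A l' - ν‖ + ‖colProj A l - ν‖ := norm_sub_le _ _
        _ ≤ 2 * B := by linarith
    have h7 : ‖colProj A l' - colProj A l‖ * y ≤ 2 * B * y := by gcongr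
    linarith
  have hlim : γ / 2 * y ^ 2 ≤ 2 * B * y := by
    refine le_of_forall_pos_le_add fun η hη => ?_
    have := key (min η (ε / 2)) (lt_min hη (by positivity)) (min_le_right _ _)
    linarith [min_le_left η (ε / 2)]
  rw [le_div_iff₀ hγ]
  rcases hy0.eq_or_lt with h0 | h0
  · rw [← h0, zero_mul]
    have := hleb.const_pos
    positivity
  · refine le_of_mul_le_mul_left ?_ h0
    nlinarith

/-- Primal accuracy after a stage. -/
lemma sub_primalValue_le_of_bound (hX : IsCompact X) (hf : ConvexOn ℝ univ f)
    (hfeas : (feasibleSet A b X).Nonempty) {c x : E d} (hc : c ∈ X) {μ γ D : ℝ}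
    (hμ : 0 ≤ μ) (hγ : 0 ≤ γ) (hdiam : ∀ x ∈ X, ∀ y ∈ X, ‖x - y‖ ≤ D) {l l₁ : E N}
    (h : smoothDual A b X f c μ l₁
      ≤ proxObj A b f c μ l x - γ / 2 * ‖residual A b x‖ ^ 2) :
    f x - primalValue A b X f ≤ μ * D ^ 2 / 2 + ‖colProj A l‖ * ‖residual A b x‖ := by
  have h1 : f x - μ * D ^ 2 / 2 - ‖colProj A l‖ * ‖residual A b x‖ ≤ primalValue A b X f := by
    refine le_csInf (hfeas.image f) (forall_mem_image.2 fun z hz => ?_)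
    have h2 := neg_le_smoothDual hX hf hc hμ hdiam hz l₁
    have h3 := inner_residual_le (A := A) (b := b) hfeas (-l) x
    have h4 : colProj A (-l) = -colProj A l := by simp only [colProj, map_neg]
    rw [h4, norm_neg, inner_neg_left] at h3
    have h5 : 0 ≤ μ / 2 * ‖x - c‖ ^ 2 := by positivity
    have h6 : 0 ≤ γ / 2 * ‖residual A b x‖ ^ 2 := by positivity
    simp only [proxObj] at h
    linarith
  linarith

/-! ### Sizes of the parameters -/

/-- This inequality is where the exponent `2 / (2 + β)` of the horizon is used: it amounts to
`β + 4 / (2 + β) ≥ 2`. -/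
lemma rpow_mul_rpow_le_sq {ε β : ℝ} (hε : 0 < ε) (hε1 : ε ≤ 1) (hβ : 0 < β) :
    ε ^ β * (ε ^ (2 / (2 + β))) ^ 2 ≤ ε ^ 2 := by
  rw [← Real.rpow_natCast (ε ^ (2 / (2 + β))), ← Real.rpow_mul hε.le, ← Real.rpow_add hε,
    ← Real.rpow_natCast]
  refine Real.rpow_le_rpow_of_exponent_ge hε hε1 ?_
  push_cast
  have : β + 2 / (2 + β) * 2 - 2 = β ^ 2 / (2 + β) := by field_simp; ring
  have h2 : 0 ≤ β ^ 2 / (2 + β) := by positivity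
  linarith

/-- The gain `(μ / σ_max) S_T` of a stage whose horizon respects the lower bound. -/
lemma gain_ge {D M β C ε μ S : ℝ} {T : ℕ} (hμ : 0 ≤ μ) (hM : 0 < M) (hD : 0 < D) (hC : 0 < C)
    (hε : 0 < ε) (hσ : 0 < sigmaMax A) (hT : horizonBound A D M β C ε ≤ T)
    (hS : (T : ℝ) ^ 2 / 4 ≤ S) :
    4 * C ^ 2 * (2 * M) ^ β / (ε ^ (2 / (2 + β))) ^ 2 * (μ * D ^ 2) ≤ μ / sigmaMax A * S := by
  have hH0 : 0 ≤ horizonBound A D M β C ε := by unfold horizonBound; positivity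
  have hH : horizonBound A D M β C ε ^ 2
      = 16 * D ^ 2 * C ^ 2 * sigmaMax A * (2 * M) ^ β / (ε ^ (2 / (2 + β))) ^ 2 := by
    have hm : ((2 * M) ^ (β / 2)) ^ 2 = (2 * M) ^ β := by
      rw [← Real.rpow_natCast, ← Real.rpow_mul (by positivity)]
      congr 1
      push_cast
      ring
    rw [horizonBound, div_pow, mul_pow, mul_pow, mul_pow, mul_pow, Real.sq_sqrt hσ.le, hm]
    ring
  have h1 : horizonBound A D M β C ε ^ 2 / 4 ≤ S := le_trans (by gcongr) hS
  have hεp : 0 < ε ^ (2 / (2 + β)) := Real.rpow_pos_of_pos hε _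
  calc _ = μ / sigmaMax A * (horizonBound A D M β C ε ^ 2 / 4) := by
        rw [hH]; field_simp; ring
    _ ≤ _ := by gcongr

/-! ### The homotopy method -/

lemma homotopy_mu (D ε₀ : ℝ) (x₀ : E d) (T k : ℕ) :
    (homotopy A b X f D ε₀ x₀ T k).mu = ε₀ / D ^ 2 / 2 ^ k := by
  induction k with
  | zero => simp [homotopy]
  | succ k ih =>
    change (homotopy A b X f D ε₀ x₀ T k).mu / 2 = _
    rw [ih, pow_succ 2 k, div_div]

lemma homotopy_steps (D ε₀ : ℝ) (x₀ : E d) (T k : ℕ) :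
    (homotopy A b X f D ε₀ x₀ T k).steps = T * k := by
  induction k with
  | zero => simp [homotopy]
  | succ k ih =>
    change (homotopy A b X f D ε₀ x₀ T k).steps + (pds A b X f _ _ _ T).steps = _
    rw [ih, pds_steps, mul_add, mul_one]

lemma homotopy_primal_mem (hX : IsCompact X) (hXc : Convex ℝ X) (hf : ConvexOn ℝ univ f)
    (D ε₀ : ℝ) {x₀ : E d} (hx₀ : x₀ ∈ X) {T : ℕ} (hT : 1 ≤ T) (k : ℕ) :
    (homotopy A b X f D ε₀ x₀ T k).primal ∈ X := by
  cases k with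
  | zero => exact hx₀
  | succ k => exact pds_average_mem hX hXc ⟨x₀, hx₀⟩ hf _ _ _ T hT

/-- Stage `k` of the homotopy method reaches dual accuracy `ε₀ / 2ᵏ`, as long as the accuracy
`ε₀ / 2ᵏ⁻¹` of the stage before is not yet below `ε`. -/
lemma homotopy_dual_le (hX : IsCompact X) (hXc : Convex ℝ X) (hf : ConvexOn ℝ univ f)
    (hfeas : (feasibleSet A b X).Nonempty) (hσ : 0 ≤ sigmaMax A)
    {D M β δ C ε₀ ε : ℝ} (hD : 0 < D) (hdiam : ∀ x ∈ X, ∀ y ∈ X, ‖x - y‖ ≤ D)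
    (hM : 0 < M) (hbdd : ∀ x ∈ X, |f x| ≤ M) (hleb : LocalErrorBound A b X f β δ C) {ν : E N}
    (hν : ∀ l ∈ multipliers A b X f, colProj A l = ν) (hε₀ : 2 * M ≤ ε₀)
    {x₀ : E d} (hx₀ : x₀ ∈ X) (hε : 0 < ε) (hεδ : ε ≤ δ) (hεM : ε ≤ 2 * M) (hε1 : ε ≤ 1) {T : ℕ}
    (hT : 1 ≤ T) (hTH : horizonBound A D M β C ε ≤ T) (k : ℕ) (hk : ε * 2 ^ k ≤ 2 * ε₀) :
    dualFn A b X f (homotopy A b X f D ε₀ x₀ T k).dual - dualValue A b X f ≤ ε₀ / 2 ^ k := by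
  obtain ⟨l₀, hl₀⟩ := hleb.nonempty
  have hC := hleb.const_pos
  have hβ := hleb.exponent_pos
  have hε₀0 : 0 < ε₀ := by linarith
  induction k with
  | zero =>
    change dualFn A b X f 0 - _ ≤ _
    rw [pow_zero, div_one]
    have h1 : dualFn A b X f 0 ≤ M := by
      rw [dualFn_eq_smoothDual 0 x₀]
      refine smoothDual_le ⟨x₀, hx₀⟩ fun y hy => ?_
      simp only [proxObj, inner_zero_left, neg_zero, zero_sub, zero_div, zero_mul, sub_zero]
      exact (neg_le_abs _).trans (hbdd y hy)
    obtain ⟨z, hz⟩ := hfeas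
    have h2 := neg_le_smoothDual hX hf hx₀ le_rfl hdiam hz l₀
    rw [← dualFn_eq_smoothDual, ← dualValue_eq hl₀] at h2
    have h3 := (le_abs_self _).trans (hbdd z hz.1)
    linarith
  | succ k ih =>
    have hk' : ε * 2 ^ k ≤ ε₀ := by rw [pow_succ] at hk; linarith
    have ih := ih (by linarith)
    have hmu := homotopy_mu (A := A) (b := b) (X := X) (f := f) D ε₀ x₀ T k
    have hc := homotopy_primal_mem (A := A) (b := b) hX hXc hf D ε₀ hx₀ hT k
    set s := homotopy A b X f D ε₀ x₀ T k
    have hs0 : 0 ≤ s.mu / 2 := by rw [hmu]; positivity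
    have hbound := pds_bound (A := A) (b := b) hX hXc ⟨x₀, hx₀⟩ hf hσ s.dual s.primal hs0 hT
    have hxX := pds_average_mem (A := A) (b := b) hX hXc ⟨x₀, hx₀⟩ hf s.dual s.primal (s.mu / 2) T hT
    have hS := (pds_weight (A := A) (b := b) (X := X) (f := f) s.dual s.primal (s.mu / 2) T).2.2.2
    have hmuD : s.mu / 2 * D ^ 2 = ε₀ / 2 ^ (k + 1) := by
      rw [hmu]; field_simp; ring
    have hεk : ε ≤ ε₀ / 2 ^ k := by rwa [le_div_iff₀ (by positivity)]
    have hp := norm_colProj_sub_le hX ⟨x₀, hx₀⟩ hf hleb hν hε hεδ hεk ih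
    rw [← hν l₀ hl₀] at hp
    have hσ_cases := hσ.eq_or_lt
    rw [← hmuD]
    refine dualFn_sub_le_of_bound hX hf hfeas hc hxX hs0 hdiam hbound hl₀ hp ?_
    rcases hσ_cases with h0 | h0
    · exact Or.inl (residual_eq_zero_of_sigmaMax_nonpos hfeas h0.ge _)
    · right
      have hg := gain_ge hs0 hM hD hC hε h0 hTH hS
      rw [hmuD] at hg ⊢
      set e := ε₀ / 2 ^ (k + 1) with he
      have he0 : 0 < e := by positivity
      have he2 : ε₀ / 2 ^ k = 2 * e := by rw [he, pow_succ]; field_simp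
      rw [he2]
      set w := ε ^ (2 / (2 + β))
      have hw : 0 < w := Real.rpow_pos_of_pos hε _
      have hq : 0 < ε ^ β := Real.rpow_pos_of_pos hε _
      have hm : 0 < (2 * M) ^ β := Real.rpow_pos_of_pos (by linarith) _
      refine ⟨lt_of_lt_of_le (by positivity) hg, ?_⟩
      refine le_trans ?_ (mul_le_mul_of_nonneg_right hg he0.le)
      have h1 := rpow_mul_rpow_le_sq hε hε1 hβ
      have h2 : ε ^ β ≤ (2 * M) ^ β := Real.rpow_le_rpow hε.le hεM hβ.le
      have h3 : ε ^ β * (ε ^ β * w ^ 2) ≤ (2 * M) ^ β * ε ^ 2 := by gcongr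
      have h4 : (ε ^ β) ^ 2 / ε ^ 2 ≤ (2 * M) ^ β / w ^ 2 := by
        rw [div_le_div_iff₀ (by positivity) (by positivity)]
        linarith
      calc (C * ε ^ β * (2 * e / ε)) ^ 2 = 4 * C ^ 2 * e ^ 2 * ((ε ^ β) ^ 2 / ε ^ 2) := by
            field_simp; ring
        _ ≤ 4 * C ^ 2 * e ^ 2 * ((2 * M) ^ β / w ^ 2) := by gcongr
        _ = _ := by field_simp

/-- Accuracy of the homotopy method one stage after the dual accuracy `ε` is reached. -/
lemma homotopy_accuracy (hX : IsCompact X) (hXc : Convex ℝ X) (hf : ConvexOn ℝ univ f)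
    (hfeas : (feasibleSet A b X).Nonempty) (hσ : 0 ≤ sigmaMax A)
    {D M β δ C ε₀ ε : ℝ} (hD : 0 < D) (hdiam : ∀ x ∈ X, ∀ y ∈ X, ‖x - y‖ ≤ D)
    (hM : 0 < M) (hbdd : ∀ x ∈ X, |f x| ≤ M) (hleb : LocalErrorBound A b X f β δ C) {ν : E N}
    (hν : ∀ l ∈ multipliers A b X f, colProj A l = ν) (hε₀ : 2 * M ≤ ε₀)
    {x₀ : E d} (hx₀ : x₀ ∈ X) (hε : 0 < ε) (hεδ : ε ≤ δ) (hεM : ε ≤ 2 * M) (hε1 : ε ≤ 1) {T : ℕ}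
    (hT : 1 ≤ T) (hTH : horizonBound A D M β C ε ≤ T) {n : ℕ} (hn : ε₀ ≤ ε * 2 ^ n)
    (hn' : ε * 2 ^ n ≤ 2 * ε₀) :
    ‖residual A b (homotopy A b X f D ε₀ x₀ T (n + 1)).primal‖ ≤ 4 * ε / (C * (2 * M) ^ β) ∧
      f (homotopy A b X f D ε₀ x₀ T (n + 1)).primal - primalValue A b X f
        ≤ (‖ν‖ + C * ε ^ β) * (4 * ε / (C * (2 * M) ^ β)) + ε / 4 := by
  have hC := hleb.const_pos
  have hβ := hleb.exponent_pos
  have hε₀0 : 0 < ε₀ := by linarith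
  have hdual := homotopy_dual_le hX hXc hf hfeas hσ hD hdiam hM hbdd hleb hν hε₀ hx₀ hε hεδ hεM hε1
    hT hTH n hn'
  have hmu := homotopy_mu (A := A) (b := b) (X := X) (f := f) D ε₀ x₀ T n
  have hc := homotopy_primal_mem (A := A) (b := b) hX hXc hf D ε₀ hx₀ hT n
  change ‖residual A b ((pds A b X f (homotopy A b X f D ε₀ x₀ T n).dual
      (homotopy A b X f D ε₀ x₀ T n).primal ((homotopy A b X f D ε₀ x₀ T n).mu / 2) T).weight⁻¹ •
    (pds A b X f (homotopy A b X f D ε₀ x₀ T n).dual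
      (homotopy A b X f D ε₀ x₀ T n).primal ((homotopy A b X f D ε₀ x₀ T n).mu / 2) T).weighted)‖ ≤ _
    ∧ f ((pds A b X f (homotopy A b X f D ε₀ x₀ T n).dual
      (homotopy A b X f D ε₀ x₀ T n).primal ((homotopy A b X f D ε₀ x₀ T n).mu / 2) T).weight⁻¹ •
    (pds A b X f (homotopy A b X f D ε₀ x₀ T n).dual
      (homotopy A b X f D ε₀ x₀ T n).primal ((homotopy A b X f D ε₀ x₀ T n).mu / 2) T).weighted)
      - _ ≤ _
  set s := homotopy A b X f D ε₀ x₀ T n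
  have hs0 : 0 ≤ s.mu / 2 := by rw [hmu]; positivity
  have hbound := pds_bound (A := A) (b := b) hX hXc ⟨x₀, hx₀⟩ hf hσ s.dual s.primal hs0 hT
  have hxX := pds_average_mem (A := A) (b := b) hX hXc ⟨x₀, hx₀⟩ hf s.dual s.primal (s.mu / 2) T hT
  have hS := (pds_weight (A := A) (b := b) (X := X) (f := f) s.dual s.primal (s.mu / 2) T).2.2.2
  set r := pds A b X f s.dual s.primal (s.mu / 2) T
  set x := r.weight⁻¹ • r.weighted
  simp only at hS hbound
  have hmuD : s.mu / 2 * D ^ 2 = ε₀ / 2 ^ n / 2 := by rw [hmu]; field_simp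
  have hhi : ε₀ / 2 ^ n ≤ ε := by rwa [div_le_iff₀ (by positivity)]
  have hlo : ε / 2 ≤ ε₀ / 2 ^ n := by rw [le_div_iff₀ (by positivity)]; linarith
  have hp := norm_colProj_sub_le hX ⟨x₀, hx₀⟩ hf hleb hν hε hεδ le_rfl (hdual.trans hhi)
  rw [div_self hε.ne', mul_one] at hp
  set w := ε ^ (2 / (2 + β)) with hw_def
  have hw : 0 < w := Real.rpow_pos_of_pos hε _
  have hq : 0 < ε ^ β := Real.rpow_pos_of_pos hε _
  have hm : 0 < (2 * M) ^ β := Real.rpow_pos_of_pos (by linarith) _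
  have hS0 : 0 ≤ r.weight := le_trans (by positivity) hS
  have hres : ‖residual A b x‖ ≤ 4 * ε / (C * (2 * M) ^ β) := by
    rcases hσ.eq_or_lt with h0 | h0
    · rw [residual_eq_zero_of_sigmaMax_nonpos hfeas h0.ge, norm_zero]
      positivity
    · have hg := gain_ge hs0 hM hD hC hε h0 hTH hS
      rw [hmuD, ← hw_def] at hg
      have hg' : C ^ 2 * (2 * M) ^ β * ε / w ^ 2 ≤ s.mu / 2 / sigmaMax A * r.weight := by
        refine le_trans ?_ hg
        calc C ^ 2 * (2 * M) ^ β * ε / w ^ 2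
            = 4 * C ^ 2 * (2 * M) ^ β / w ^ 2 * (ε / 2 / 2) := by field_simp; ring
          _ ≤ _ := by gcongr
      have hg0 : 0 < C ^ 2 * (2 * M) ^ β * ε / w ^ 2 := by positivity
      refine (norm_residual_le_of_bound hX hf hfeas hc hxX hs0 hdiam hbound hleb hν hε hεδ
        (by rw [hmuD]; linarith) hp (hg0.trans_le hg')).trans ?_
      refine (div_le_div_of_nonneg_left (by positivity) hg0 hg').trans ?_
      have h1 := rpow_mul_rpow_le_sq hε hε1 hβ
      rw [← hw_def] at h1
      calc 4 * (C * ε ^ β) / (C ^ 2 * (2 * M) ^ β * ε / w ^ 2)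
          = 4 * (ε ^ β * w ^ 2) / (C * (2 * M) ^ β * ε) := by field_simp
        _ ≤ 4 * ε ^ 2 / (C * (2 * M) ^ β * ε) := by gcongr
        _ = _ := by field_simp
  refine ⟨hres, ?_⟩
  have hprim := sub_primalValue_le_of_bound hX hf hfeas hc hs0
    (mul_nonneg (div_nonneg hs0 hσ) hS0) hdiam hbound
  have hnorm : ‖colProj A s.dual‖ ≤ ‖ν‖ + C * ε ^ β := by
    have := norm_add_le ν (colProj A s.dual - ν)
    rw [add_sub_cancel] at this
    linarith
  have hprod : ‖colProj A s.dual‖ * ‖residual A b x‖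
      ≤ (‖ν‖ + C * ε ^ β) * (4 * ε / (C * (2 * M) ^ β)) := by gcongr
  rw [hmuD] at hprim
  linarith

/-- The ceiling in the number of stages places `ε₀ / 2ⁿ` between `ε / 2` and `ε`. -/
lemma two_pow_ceil_logb_bounds {ε₀ ε : ℝ} (hε : 0 < ε) (hεε₀ : ε ≤ ε₀) :
    ε₀ ≤ ε * 2 ^ ⌈Real.logb 2 (ε₀ / ε)⌉₊ ∧ ε * 2 ^ ⌈Real.logb 2 (ε₀ / ε)⌉₊ ≤ 2 * ε₀ := by
  have hq : 0 < ε₀ / ε := div_pos (hε.trans_le hεε₀) hε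
  have hlog : 0 ≤ Real.logb 2 (ε₀ / ε) :=
    Real.logb_nonneg one_lt_two ((one_le_div hε).2 hεε₀)
  set n := ⌈Real.logb 2 (ε₀ / ε)⌉₊
  have h1 : ε₀ / ε ≤ (2 : ℝ) ^ (n : ℝ) :=
    (Real.logb_le_iff_le_rpow one_lt_two hq).1 (Nat.le_ceil _)
  have h2 : (2 : ℝ) ^ (n : ℝ) ≤ 2 * (ε₀ / ε) := by
    calc (2 : ℝ) ^ (n : ℝ) ≤ 2 ^ (Real.logb 2 (ε₀ / ε) + 1) :=
          Real.rpow_le_rpow_of_exponent_le one_le_two (Nat.ceil_lt_add_one hlog).le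
      _ = 2 * (ε₀ / ε) := by
          rw [Real.rpow_add two_pos, Real.rpow_one,
            Real.rpow_logb two_pos (by norm_num) hq, mul_comm]
  rw [Real.rpow_natCast] at h1 h2
  constructor
  · rwa [div_le_iff₀' hε] at h1
  · calc ε * 2 ^ n ≤ ε * (2 * (ε₀ / ε)) := by gcongr
      _ = 2 * ε₀ := by field_simp

lemma minHorizon_mul_numStages_isBigO {D M β C ε₀ : ℝ} (hD : 0 < D) (hM : 0 < M) (hC : 0 < C)
    (hβ : 0 < β) (hε₀ : 1 ≤ ε₀) :
    (fun ε : ℝ => (minHorizon A D M β C ε : ℝ) * (numStages ε₀ ε : ℝ)) =O[𝓝[>] (0 : ℝ)]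
      (fun ε : ℝ => ε ^ (-(2 / (2 + β))) * Real.logb 2 (1 / ε)) := by
  set c := 4 * D * C * √(sigmaMax A) * (2 * M) ^ (β / 2) with hc
  have hc0 : 0 ≤ c := by positivity
  have hL0 : 0 ≤ Real.logb 2 ε₀ := Real.logb_nonneg one_lt_two hε₀
  refine IsBigO.of_bound ((2 + c) * (Real.logb 2 ε₀ + 3)) ?_
  filter_upwards [Ioo_mem_nhdsGT (show (0 : ℝ) < 1 / 2 by norm_num)] with ε hε
  obtain ⟨hε0, hε2⟩ := hε
  set a := ε ^ (-(2 / (2 + β))) with ha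
  have ha1 : 1 ≤ a :=
    Real.one_le_rpow_of_pos_of_le_one_of_nonpos hε0 (by linarith) (neg_nonpos.2 (by positivity))
  have hH : horizonBound A D M β C ε = c * a := by
    rw [horizonBound, ← hc, ha, Real.rpow_neg hε0.le, div_eq_mul_inv]
  have hlog1 : 1 ≤ Real.logb 2 (1 / ε) := by
    rw [Real.le_logb_iff_rpow_le one_lt_two (by positivity), Real.rpow_one, le_div_iff₀ hε0]
    linarith
  have h1 : (minHorizon A D M β C ε : ℝ) ≤ (2 + c) * a := by
    have h2 := Nat.ceil_lt_add_one (show 0 ≤ c * a by positivity)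
    rw [minHorizon, hH, Nat.cast_max, Nat.cast_one]
    have h3 : 0 ≤ c * a := by positivity
    exact max_le (by linarith) (by linarith)
  have h2 : (numStages ε₀ ε : ℝ) ≤ (Real.logb 2 ε₀ + 3) * Real.logb 2 (1 / ε) := by
    have h3 : Real.logb 2 (ε₀ / ε) = Real.logb 2 ε₀ + Real.logb 2 (1 / ε) := by
      rw [div_eq_mul_one_div, Real.logb_mul (by positivity) (by positivity)]
    have h4 := Nat.ceil_lt_add_one (show 0 ≤ Real.logb 2 (ε₀ / ε) by rw [h3]; positivity)
    rw [numStages]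
    push_cast
    nlinarith
  rw [Real.norm_of_nonneg (by positivity), Real.norm_of_nonneg (by positivity)]
  calc _ ≤ ((2 + c) * a) * ((Real.logb 2 ε₀ + 3) * Real.logb 2 (1 / ε)) := by gcongr
    _ = _ := by ring

end Homotopy

theorem theorem2 {N d : ℕ}
    (A : Matrix (Fin N) (Fin d) ℝ) (b : Homotopy.E N) (X : Set (Homotopy.E d))
    (f : Homotopy.E d → ℝ)
    (hXcompact : IsCompact X) (hXconvex : Convex ℝ X) (hf : ConvexOn ℝ univ f)
    (D M β δ C ε₀ : ℝ)
    -- (a) the feasible set is nonempty and not a single point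
    (hfeas : (Homotopy.feasibleSet A b X).Nontrivial)
    -- (b) boundedness of `X` and of `f` on `X`
    (hD : 0 < D) (hdiam : ∀ x ∈ X, ∀ y ∈ X, ‖x - y‖ ≤ D)
    (hM : 0 < M) (hbdd : ∀ x ∈ X, |f x| ≤ M)
    -- (c) local error bound of the dual function
    (hleb : Homotopy.LocalErrorBound A b X f β δ C)
    -- (d) uniqueness of the optimal multipliers modulo the null space of `Aᵀ`
    (huniq : ∃! ν : Homotopy.E N,
      ∀ l ∈ Homotopy.multipliers A b X f, Homotopy.colProj A l = ν)
    (hε₀ : max (2 * M) 1 ≤ ε₀)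
    (x₀ : Homotopy.E d) (hx₀ : x₀ ∈ X) :
    -- accuracy and exact number of maximization steps for every admissible `ε` and horizon `T`
    (∀ ε : ℝ, 0 < ε → ε ≤ min (δ / 2) (min (2 * M) 1) →
      ∀ T : ℕ, 1 ≤ T → Homotopy.horizonBound A D M β C ε ≤ (T : ℝ) →
        (Homotopy.homotopy A b X f D ε₀ x₀ T (Homotopy.numStages ε₀ ε)).primal ∈ X ∧
        (∀ l ∈ Homotopy.multipliers A b X f,
          f (Homotopy.homotopy A b X f D ε₀ x₀ T (Homotopy.numStages ε₀ ε)).primal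
              - Homotopy.primalValue A b X f
            ≤ (24 * ‖Homotopy.colProj A l‖ * (1 + C) / (C ^ 2 * (2 * M) ^ β)
                + 6 / (2 * M) ^ β + 1 / 4) * ε) ∧
        ‖Homotopy.residual A b
            (Homotopy.homotopy A b X f D ε₀ x₀ T (Homotopy.numStages ε₀ ε)).primal‖
          ≤ 24 * (1 + C) / (C ^ 2 * (2 * M) ^ β) * ε ∧
        ((Homotopy.homotopy A b X f D ε₀ x₀ T (Homotopy.numStages ε₀ ε)).steps : ℝ)
          = (T : ℝ) * ((⌈Real.logb 2 (ε₀ / ε)⌉ : ℝ) + 1)) ∧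
    -- with the smallest admissible horizon the total number of maximization steps is
    -- `O(ε^{-2/(2+β)} log₂(1/ε))` as `ε → 0⁺`
    (fun ε : ℝ => ((Homotopy.homotopy A b X f D ε₀ x₀
        (Homotopy.minHorizon A D M β C ε) (Homotopy.numStages ε₀ ε)).steps : ℝ))
      =O[𝓝[>] (0 : ℝ)]
        (fun ε : ℝ => ε ^ (-(2 / (2 + β))) * Real.logb 2 (1 / ε)) := by
  obtain ⟨ν, hν, -⟩ := huniq
  have hne := hfeas.nonempty
  have : Nontrivial (Homotopy.E d) := by
    obtain ⟨x, -, y, -, hxy⟩ := hfeas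
    exact ⟨x, y, hxy⟩
  have hσ : 0 ≤ Homotopy.sigmaMax A := Homotopy.sigmaMax_nonneg
  have hC := hleb.const_pos
  have hβ := hleb.exponent_pos
  have hε₀M : 2 * M ≤ ε₀ := (le_max_left _ _).trans hε₀
  have hε₀1 : 1 ≤ ε₀ := (le_max_right _ _).trans hε₀
  refine ⟨fun ε hε hεle T hT hTH => ?_, ?_⟩
  · have hδ : ε ≤ δ := by linarith [hεle.trans (min_le_left _ _), hleb.level_pos]
    have hεM : ε ≤ 2 * M := hεle.trans ((min_le_right _ _).trans (min_le_left _ _))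
    have hε1 : ε ≤ 1 := hεle.trans ((min_le_right _ _).trans (min_le_right _ _))
    obtain ⟨hn, hn'⟩ := Homotopy.two_pow_ceil_logb_bounds hε (hε1.trans hε₀1)
    obtain ⟨hres, hval⟩ := Homotopy.homotopy_accuracy hXcompact hXconvex hf hne hσ hD hdiam hM hbdd
      hleb hν hε₀M hx₀ hε hδ hεM hε1 hT hTH hn hn'
    have hm : 0 < (2 * M) ^ β := Real.rpow_pos_of_pos (by linarith) _
    have hC24 : 4 * ε / (C * (2 * M) ^ β) ≤ 24 * (1 + C) / (C ^ 2 * (2 * M) ^ β) * ε := by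
      rw [div_mul_eq_mul_div, div_le_div_iff₀ (by positivity) (by positivity)]
      have : 0 ≤ ε * C * (2 * M) ^ β := by positivity
      have : 0 ≤ ε * C * (2 * M) ^ β * C := by positivity
      nlinarith
    refine ⟨Homotopy.homotopy_primal_mem hXcompact hXconvex hf D ε₀ hx₀ hT _, fun l hl => ?_,
      hres.trans hC24, ?_⟩
    · rw [hν l hl]
      refine hval.trans ?_
      have h1 : ‖ν‖ * (4 * ε / (C * (2 * M) ^ β))
          ≤ ‖ν‖ * (24 * (1 + C) / (C ^ 2 * (2 * M) ^ β) * ε) := by gcongr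
      have h2 : C * ε ^ β * (4 * ε / (C * (2 * M) ^ β)) ≤ 6 / (2 * M) ^ β * ε := by
        calc C * ε ^ β * (4 * ε / (C * (2 * M) ^ β)) = ε ^ β * (4 / (2 * M) ^ β * ε) := by
              field_simp
          _ ≤ 1 * (6 / (2 * M) ^ β * ε) := by
              gcongr
              · exact Real.rpow_le_one hε.le hε1 hβ.le
              · norm_num
          _ = _ := one_mul _
      have h3 : (24 * ‖ν‖ * (1 + C) / (C ^ 2 * (2 * M) ^ β) + 6 / (2 * M) ^ β + 1 / 4) * ε
          = ‖ν‖ * (24 * (1 + C) / (C ^ 2 * (2 * M) ^ β) * ε) + 6 / (2 * M) ^ β * ε + ε / 4 := by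
        ring
      rw [h3]
      linarith
    · have hlog : 0 ≤ Real.logb 2 (ε₀ / ε) :=
        Real.logb_nonneg one_lt_two ((one_le_div hε).2 (hε1.trans hε₀1))
      rw [Homotopy.homotopy_steps, Homotopy.numStages, ← natCast_ceil_eq_intCast_ceil hlog]
      push_cast
      rfl
  · have hO := Homotopy.minHorizon_mul_numStages_isBigO (A := A) hD hM hC hβ hε₀1
    refine hO.congr_left fun ε => ?_
    rw [Homotopy.homotopy_steps]
    push_cast
    rfl
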